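/- Let $\mathbb T=\{z\in\mathbb C:|z|=1\}$ with normalized Haar measure, let $e_k(z)=z^k$ ($k\in\mathbb Z$) be the standard orthonormal basis of $L^2(\mathbb T)$, and let $\langle\cdot\mid\cdot\rangle$ be the inner product of $L^2(\mathbb T)$, conjugate-linear in the first variable. Let $m_0:\mathbb T\to\mathbb C$ be a measurable function with $m_0(1)=\sqrt2$ and $|m_0(z)|^2+|m_0(-z)|^2=2$ for all $z\in\mathbb T$; put $m_1(z)=z\,\overline{m_0(-z)}$ and let $S_0,S_1$ be the operators on $L^2(\mathbb T)$ given by $(S_if)(z)=m_i(z)f(z^2)$. Write $m_i(x):=m_i(e^{i2\pi x})$ for $x\in\mathbb R$, and let $\hat f$ denote the Fourier transform on $L^2(\mathbb R)$ normalized by $\hat f(x)=\int_{\mathbb R}f(t)e^{i2\pi xt}\,dt$. Let $\varphi_0,\varphi_1,\varphi_2,\dots\in L^2(\mathbb R)$ satisfy, for every $n\in\mathbb N_0$ and almost every $x\in\mathbb R$, $$\widehat{\varphi_{2n}}(x)=\tfrac1{\sqrt2}\,m_0\!\left(\tfrac x2\right)\widehat{\varphi_n}\!\left(\tfrac x2\right),\qquad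 \widehat{\varphi_{2n+1}}(x)=\tfrac1{\sqrt2}\,m_1\!\left(\tfrac x2\right)\widehat{\varphi_n}\!\left(\tfrac x2\right),$$ and suppose that the family $\{\varphi_n(t-k)\mid n\in\mathbb N_0,\ k\in\mathbb Z\}$ is an orthonormal basis (ONB) of $L^2(\mathbb R)$. Then for all $p,n\in\mathbb N_0$ and $k\in\mathbb Z$, $$2^{p/2}\varphi_n(2^pt-k)=\sum_{i_1=0}^1\cdots\sum_{i_p=0}^1\ \sum_{j\in\mathbb Z}\left\langle e_j\mid S_{i_p}^*\cdots S_{i_1}^*e_k\right\rangle\,\varphi_{2^pn+2^{p-1}i_1+2^{p-2}i_2+\cdots+i_p}(t-j),$$ where the series over $j$ converge unconditionally in $L^2(\mathbb R)$. Moreover, for every subset $J\subset\mathbb N_0\times\mathbb N_0$, the family $$\{2^{p/2}\varphi_n(2^pt-k)\mid (p,n)\in J,\ k\in\mathbb Z\},$$ indexed by $(p,n,k)\in J\times\mathbb Z$, is an ONB of $L^2(\mathbb R)$ if and only if the sets $[2^pn,2^p(n+1))\cap\mathbb N_0$, $(p,n)\in J$, are pairwise disjoint and have union $\mathbb N_0$.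 -/

import Mathlib

open MeasureTheory
open scoped ENNReal ComplexConjugate FourierTransform

noncomputable section

namespace WaveletPacket

/-- The Hilbert space `L²(ℝ)` of complex-valued functions, with Lebesgue measure. -/
abbrev L2R : Type := Lp ℂ 2 (volume : Measure ℝ)

/-- The Hilbert space `L²(𝕋)`, realized on `ℝ/ℤ` with normalized Haar measure through the
identification `θ ↦ z = e^{2πiθ}`, which is `AddCircle.toCircle`. -/
abbrev L2T : Type := Lp ℂ 2 (AddCircle.haarAddCircle : Measure UnitAddCircle)

/-- The standard basis vector `e_k(z) = z^k` of `L²(𝕋)`. -/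
def e (k : ℤ) : L2T := fourierLp 2 k

/-- An orthonormal basis given as an indexed family: orthonormal, with dense linear span. -/
def IsONB {ι H : Type*} [NormedAddCommGroup H] [InnerProductSpace ℂ H] (v : ι → H) : Prop :=
  Orthonormal ℂ v ∧ (Submodule.span ℂ (Set.range v)).topologicalClosure = ⊤

/-- The two filters: `m_0` is given and `m_1(z) = z * conj (m_0(-z))`. -/
def filt (m₀ : Circle → ℂ) : Fin 2 → Circle → ℂ :=
  ![m₀, fun z => (z : ℂ) * conj (m₀ (-z))]

/-- Doubling `θ ↦ 2θ` on `ℝ/ℤ`, i.e. `z ↦ z²` on the circle, preserves Haar measure. -/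
theorem measurePreserving_double :
    MeasurePreserving (fun θ : UnitAddCircle => (2 : ℤ) • θ)
      AddCircle.haarAddCircle AddCircle.haarAddCircle :=
  Measure.measurePreserving_zsmul AddCircle.haarAddCircle two_ne_zero

/-- The operator `(S f)(z) = m(z) f(z²)` on `L²(𝕋)`, for an essentially bounded `m`. -/
def filterOp (m : Circle → ℂ)
    (hm : MemLp (fun θ : UnitAddCircle => m θ.toCircle) ∞ AddCircle.haarAddCircle) :
    L2T →L[ℂ] L2T :=
  ((ContinuousLinearMap.mul ℂ ℂ).holderL AddCircle.haarAddCircle ∞ 2 2 hm.toLp) ∘L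
    (Lp.compMeasurePreservingₗᵢ ℂ (fun θ : UnitAddCircle => (2 : ℤ) • θ)
      measurePreserving_double).toContinuousLinearMap

theorem filterOp_coeFn (m : Circle → ℂ)
    (hm : MemLp (fun θ : UnitAddCircle => m θ.toCircle) ∞ AddCircle.haarAddCircle) (f : L2T) :
    filterOp m hm f =ᵐ[AddCircle.haarAddCircle] fun θ => m θ.toCircle * f ((2 : ℤ) • θ) := by
  have h := (ContinuousLinearMap.mul ℂ ℂ).coeFn_holder (r := 2) hm.toLp
    (Lp.compMeasurePreserving (fun θ : UnitAddCircle => (2 : ℤ) • θ) measurePreserving_double f)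
  filter_upwards [h, hm.coeFn_toLp, Lp.coeFn_compMeasurePreserving f measurePreserving_double]
    with θ h₁ h₂ h₃
  rw [h₂, h₃] at h₁
  exact h₁

/-- `-z = e^{2πi(θ + 1/2)}` for `z = e^{2πiθ}`. -/
theorem neg_toCircle (θ : UnitAddCircle) :
    -θ.toCircle = (θ + ((1 / 2 : ℝ) : UnitAddCircle)).toCircle := by
  rw [AddCircle.toCircle_add, AddCircle.toCircle_apply_mk]
  have : Circle.exp (2 * Real.pi / 1 * (1 / 2)) = -1 := by
    rw [show 2 * Real.pi / 1 * (1 / 2) = Real.pi by ring]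
    ext
    simp
  rw [this]
  simp

/-- The quadrature condition `|m_0(z)|² + |m_0(-z)|² = 2` makes both filters bounded. -/
theorem filt_memLp (m₀ : Circle → ℂ)
    (hmeas : Measurable fun θ : UnitAddCircle => m₀ θ.toCircle)
    (hqmf : ∀ z : Circle, ‖m₀ z‖ ^ 2 + ‖m₀ (-z)‖ ^ 2 = 2) (i : Fin 2) :
    MemLp (fun θ : UnitAddCircle => filt m₀ i θ.toCircle) ∞ AddCircle.haarAddCircle := by
  have hb : ∀ z, ‖m₀ z‖ ≤ 2 := fun z => by
    nlinarith [hqmf z, norm_nonneg (m₀ z), sq_nonneg ‖m₀ (-z)‖]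
  have hneg : Measurable fun θ : UnitAddCircle => m₀ (-θ.toCircle) := by
    simp_rw [neg_toCircle]
    exact hmeas.comp (measurable_add_const _)
  fin_cases i
  · exact memLp_top_of_bound hmeas.aestronglyMeasurable 2 (.of_forall fun θ => hb _)
  · refine memLp_top_of_bound (Measurable.aestronglyMeasurable ?_) 2 (.of_forall fun θ => ?_)
    · have hc : Measurable fun θ : UnitAddCircle => (θ.toCircle : ℂ) :=
        (continuous_subtype_val.comp AddCircle.continuous_toCircle).measurable
      exact hc.mul (Complex.continuous_conj.measurable.comp hneg)
    · simpa [filt, Circle.norm_coe] using hb (-θ.toCircle)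

/-- The operators `(S_i f)(z) = m_i(z) f(z²)`, `i = 0, 1`, on `L²(𝕋)`. -/
def S (m₀ : Circle → ℂ) (hmeas : Measurable fun θ : UnitAddCircle => m₀ θ.toCircle)
    (hqmf : ∀ z : Circle, ‖m₀ z‖ ^ 2 + ‖m₀ (-z)‖ ^ 2 = 2) (i : Fin 2) : L2T →L[ℂ] L2T :=
  filterOp (filt m₀ i) (filt_memLp m₀ hmeas hqmf i)

/-- The word `T_{i_p}^* ⋯ T_{i_1}^*` of adjoints of `T_0, T_1`, where `i_r = i (r - 1)`;
`T_{i_1}^*` acts first. -/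
def adjWord (T : Fin 2 → L2T →L[ℂ] L2T) : (p : ℕ) → (Fin p → Fin 2) → L2T →L[ℂ] L2T
  | 0, _ => ContinuousLinearMap.id ℂ L2T
  | p + 1, i => adjWord T p (Fin.tail i) ∘L ContinuousLinearMap.adjoint (T (i 0))

/-- The index `2^p n + 2^{p-1} i_1 + 2^{p-2} i_2 + ⋯ + i_p`, where `i_r = i (r - 1)`. -/
def packetIndex (p n : ℕ) (i : Fin p → Fin 2) : ℕ :=
  2 ^ p * n + ∑ r : Fin p, (i r : ℕ) * 2 ^ (p - 1 - (r : ℕ))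

theorem atom_memLp (f : L2R) (p : ℕ) (k : ℤ) :
    MemLp (fun t : ℝ => (((2 : ℝ) ^ ((p : ℝ) / 2) : ℝ) : ℂ) * f (2 ^ p * t - k)) 2 volume := by
  have ha : (2 : ℝ) ^ p ≠ 0 := by positivity
  have h₁ : MemLp (fun s : ℝ => f (s - k)) 2 volume :=
    (Lp.memLp f).comp_measurePreserving (measurePreserving_sub_right volume (k : ℝ))
  have h₂ : MemLp (fun s : ℝ => f (s - k)) 2 (volume.map fun t : ℝ => 2 ^ p * t) := by
    rw [Real.map_volume_mul_left ha]
    exact h₁.smul_measure ENNReal.ofReal_ne_top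
  exact (h₂.comp_of_map (by fun_prop)).const_mul _

/-- The function `t ↦ 2^{p/2} f(2^p t - k)` as an element of `L²(ℝ)`; for `p = 0` it is the
translate `t ↦ f(t - k)`. -/
def atom (f : L2R) (p : ℕ) (k : ℤ) : L2R := (atom_memLp f p k).toLp

/-- The Fourier transform on `L²(ℝ)`, the unitary extension of `f̂(x) = ∫ f(t) e^{2πixt} dt`. -/
def hat (f : L2R) : L2R := 𝓕⁻ f

/-- The wavelet-packet recursion in the Fourier domain:
`φ̂_{2n+i}(x) = 2^{-1/2} m_i(e^{2πi x/2}) φ̂_n(x/2)` for `n ≥ 0` and `i = 0, 1`. -/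
def IsPacketSequence (m₀ : Circle → ℂ) (φ : ℕ → L2R) : Prop :=
  ∀ (n : ℕ) (i : Fin 2), hat (φ (2 * n + i)) =ᵐ[volume] fun x : ℝ =>
    ((1 / √2 : ℝ) : ℂ) * filt m₀ i (Circle.exp (2 * Real.pi * (x / 2))) * hat (φ n) (x / 2)

/-- The dyadic block `[2^p n, 2^p (n+1))` of nonnegative integers attached to `(p, n)`. -/
def block (q : ℕ × ℕ) : Set ℕ := Set.Ico (2 ^ q.1 * q.2) (2 ^ q.1 * (q.2 + 1))

end WaveletPacket

end

noncomputable section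

namespace WaveletPacket

/-! Write `D` for the unitary dilation `f ↦ √2 f(2t)` and `U_n` for the isometry from `L²(𝕋)` taking
`e_k` to `φ_n(t - k)` (`synth`). On the Fourier side `U_n ξ` is `φ̂_n` times the periodization of
`ξ` (`hat_synth`), so the packet recursion becomes the operator identity `D U_n S_i = U_{2n+i}`
(`dilate_synth_S`). The ranges of the `U_n` are mutually orthogonal, so this identity makes the
`S_i` isometries with orthogonal ranges. The quadrature condition makes those ranges fill `L²(𝕋)`
(`eq_zero_of_orthogonal_S`), hence `∑ S_i S_i^* = 1`. Therefore `D U_n = ∑ U_{2n+i} S_i^*`, and `p`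
iterations give the expansion (`atom_eq_sum_adjWord`). Consequently the closed span of the atoms
attached to `(p, n)` is the orthogonal sum of the ranges of `U_m` for `m` in the dyadic block of
`(p, n)`. An ONB then corresponds to a partition of `ℕ` into blocks. -/

open Filter Topology in
-- `L²` limits are a.e. limits along a subsequence. Since `c` need not be bounded, the right side
-- need not define an `L²`-continuous map, so the identity is passed to the limit pointwise.
theorem isClosed_setOf_ae_eq_mul_comp {E X Y : Type*} [TopologicalSpace E] [SequentialSpace E]
    [MeasurableSpace X] [MeasurableSpace Y] {μ : Measure X} {ν : Measure Y}
    {A : E → Lp ℂ 2 μ} {B : E → Lp ℂ 2 ν} (hA : Continuous A) (hB : Continuous B)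
    {q : X → Y} (hq : Measure.QuasiMeasurePreserving q μ ν) (c : X → ℂ) :
    IsClosed {f : E | A f =ᵐ[μ] fun x => c x * B f (q x)} := by
  refine IsSeqClosed.isClosed fun f g hf hfg => ?_
  obtain ⟨ns, hns, h₁⟩ := (tendstoInMeasure_of_tendsto_Lp
    ((hA.tendsto g).comp hfg)).exists_seq_tendsto_ae
  -- A further subsequence of `ns`, so that both sides converge along the same indices.
  obtain ⟨ms, hms, h₂⟩ := (tendstoInMeasure_of_tendsto_Lp
    ((hB.tendsto g).comp (hfg.comp hns.tendsto_atTop))).exists_seq_tendsto_ae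
  have hall : ∀ᵐ x ∂μ, ∀ n, A (f n) x = c x * B (f n) (q x) := ae_all_iff.2 hf
  filter_upwards [h₁, hq.ae h₂, hall] with x h₁ h₂ h
  refine tendsto_nhds_unique (h₁.comp hms.tendsto_atTop) ?_
  simpa [Function.comp_def, h] using h₂.const_mul (c x)

/-- Pushing all of Lebesgue measure to the circle gives an infinite measure, but null sets can be
tested on the fundamental domain `(0, 1]`. -/
theorem quasiMeasurePreserving_coe_unitAddCircle :
    Measure.QuasiMeasurePreserving ((↑) : ℝ → UnitAddCircle) volume
      AddCircle.haarAddCircle := by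
  refine ⟨AddCircle.measurable_mk', ?_⟩
  have h := (UnitAddCircle.measurePreserving_mk 0).map_eq
  have h' := (isAddFundamentalDomain_Ioc' one_pos 0).absolutelyContinuous_map
  rw [AddCircle.volume_eq_smul_haarAddCircle, ENNReal.ofReal_one, one_smul] at h
  rw [← h]
  exact h'

theorem quasiMeasurePreserving_mul_left {a : ℝ} (ha : a ≠ 0) :
    Measure.QuasiMeasurePreserving (fun t : ℝ => a * t) volume volume := by
  refine ⟨by fun_prop, ?_⟩
  rw [Real.map_volume_mul_left ha]
  exact Measure.smul_absolutelyContinuous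

/-! ### Atoms as isometries of `L²(ℝ)` -/

theorem atom_coeFn (f : L2R) (p : ℕ) (k : ℤ) :
    atom f p k =ᵐ[volume]
      fun t : ℝ => (((2 : ℝ) ^ ((p : ℝ) / 2) : ℝ) : ℂ) * f (2 ^ p * t - k) :=
  MemLp.coeFn_toLp _

theorem quasiMeasurePreserving_affine (p : ℕ) (k : ℤ) :
    Measure.QuasiMeasurePreserving (fun t : ℝ => 2 ^ p * t - k) volume volume :=
  (measurePreserving_sub_right volume (k : ℝ)).quasiMeasurePreserving.comp
    (quasiMeasurePreserving_mul_left (by positivity))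

theorem norm_atom (f : L2R) (p : ℕ) (k : ℤ) : ‖atom f p k‖ = ‖f‖ := by
  have ha : (0 : ℝ) < 2 ^ p := by positivity
  have h₁ : eLpNorm (fun t : ℝ => f (2 ^ p * t - k)) 2 volume =
      ENNReal.ofReal ((2 : ℝ) ^ p)⁻¹ ^ (1 / 2 : ℝ) * eLpNorm f 2 volume := by
    have hs := measurePreserving_sub_right volume (k : ℝ)
    have e₁ : eLpNorm (fun s : ℝ => f (s - k)) 2 volume = eLpNorm f 2 volume :=
      eLpNorm_comp_measurePreserving (Lp.aestronglyMeasurable f) hs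
    have hm : AEStronglyMeasurable (fun s : ℝ => f (s - k)) volume :=
      (Lp.aestronglyMeasurable f).comp_measurePreserving hs
    have e₂ := eLpNorm_map_measure (p := 2) (μ := volume) (f := fun t : ℝ => 2 ^ p * t)
      (g := fun s : ℝ => f (s - k))
      (hm.mono_ac (quasiMeasurePreserving_mul_left ha.ne').absolutelyContinuous) (by fun_prop)
    rw [Real.map_volume_mul_left ha.ne',
      eLpNorm_smul_measure_of_ne_top (by norm_num), e₁, abs_of_pos (by positivity)] at e₂
    simpa [Function.comp_def] using e₂.symm
  have h₂ : ‖(((2 : ℝ) ^ ((p : ℝ) / 2) : ℝ) : ℂ)‖ₑ =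
      ENNReal.ofReal ((2 : ℝ) ^ p) ^ (1 / 2 : ℝ) := by
    rw [ENNReal.ofReal_rpow_of_pos ha, ← ofReal_norm, Complex.norm_real,
      Real.norm_of_nonneg (by positivity), ← Real.rpow_natCast, ← Real.rpow_mul (by norm_num)]
    congr 2
    ring
  rw [Lp.norm_def, Lp.norm_def, eLpNorm_congr_ae (atom_coeFn f p k)]
  have h₃ := eLpNorm_const_smul (((2 : ℝ) ^ ((p : ℝ) / 2) : ℝ) : ℂ)
    (fun t : ℝ => f (2 ^ p * t - k)) 2 volume
  simp only [Pi.smul_def, smul_eq_mul] at h₃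
  rw [h₃, h₁, h₂, ← mul_assoc, ← ENNReal.mul_rpow_of_nonneg _ _ (by norm_num),
    ← ENNReal.ofReal_mul ha.le, mul_inv_cancel₀ ha.ne']
  simp

/-- The map `f ↦ 2^{p/2} f(2^p t - k)` as a linear isometry of `L²(ℝ)`. -/
def atomₗᵢ (p : ℕ) (k : ℤ) : L2R →ₗᵢ[ℂ] L2R where
  toFun f := atom f p k
  map_add' f g := by
    refine Lp.ext ?_
    filter_upwards [atom_coeFn (f + g) p k, atom_coeFn f p k, atom_coeFn g p k,
      Lp.coeFn_add (atom f p k) (atom g p k),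
      (quasiMeasurePreserving_affine p k).ae (Lp.coeFn_add f g)] with t h₁ h₂ h₃ h₄ h₅
    rw [h₁, h₄, Pi.add_apply, h₂, h₃, h₅, Pi.add_apply, mul_add]
  map_smul' c f := by
    refine Lp.ext ?_
    filter_upwards [atom_coeFn (c • f) p k, atom_coeFn f p k,
      Lp.coeFn_smul c (atom f p k),
      (quasiMeasurePreserving_affine p k).ae (Lp.coeFn_smul c f)] with t h₁ h₂ h₄ h₅
    rw [h₁, RingHom.id_apply, h₄, Pi.smul_apply, h₂, h₅, Pi.smul_apply, smul_eq_mul, smul_eq_mul,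
      mul_left_comm]
  norm_map' f := norm_atom f p k

@[simp]
theorem atomₗᵢ_apply (p : ℕ) (k : ℤ) (f : L2R) : atomₗᵢ p k f = atom f p k := rfl

theorem continuous_atom (p : ℕ) (k : ℤ) : Continuous fun f : L2R => atom f p k :=
  (atomₗᵢ p k).continuous

theorem atom_zero_zero (f : L2R) : atom f 0 0 = f := by
  refine Lp.ext ?_
  filter_upwards [atom_coeFn f 0 0] with t h
  simp [h]

theorem atom_atom (f : L2R) (p : ℕ) (k : ℤ) : atom (atom f p k) 1 0 = atom f (p + 1) k := by
  refine Lp.ext ?_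
  filter_upwards [atom_coeFn (atom f p k) 1 0, atom_coeFn f (p + 1) k,
    (quasiMeasurePreserving_affine 1 0).ae (atom_coeFn f p k)] with t h₁ h₂ h₃
  rw [h₁, h₂, h₃, ← mul_assoc, ← Complex.ofReal_mul, ← Real.rpow_add (by norm_num)]
  congr 3
  · push_cast
    ring_nf
  · push_cast
    ring

/-! ### Fourier transform of translates and dilates -/

theorem continuous_hat : Continuous hat := (Lp.fourierTransformₗᵢ ℝ ℂ).symm.continuous

theorem hat_injective : Function.Injective hat := (Lp.fourierTransformₗᵢ ℝ ℂ).symm.injective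

theorem hat_toLp (f : SchwartzMap ℝ ℂ) :
    hat (f.toLp 2) =ᵐ[volume] fun x : ℝ =>
      ∫ t : ℝ, Complex.exp (2 * Real.pi * x * t * Complex.I) * f t := by
  rw [hat, SchwartzMap.toLp_fourierInv_eq]
  filter_upwards [(𝓕⁻ f).coeFn_toLp 2 volume] with x hx
  rw [hx, SchwartzMap.fourierInv_coe, Real.fourierInv_eq']
  refine integral_congr_ae (.of_forall fun t => ?_)
  simp only [smul_eq_mul, RCLike.inner_apply, conj_trivial]
  congr 2
  push_cast
  ring

theorem denseRange_schwartz_toLp : DenseRange fun f : SchwartzMap ℝ ℂ => (f.toLp 2 : L2R) :=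
  SchwartzMap.denseRange_toLpCLM ENNReal.ofNat_ne_top

theorem atom_translate_toLp (f : SchwartzMap ℝ ℂ) (k : ℤ) :
    atom (f.toLp 2) 0 k = (f.compSubConstCLM ℂ (k : ℝ)).toLp 2 := by
  refine Lp.ext ?_
  filter_upwards [atom_coeFn (f.toLp 2) 0 k, (f.compSubConstCLM ℂ (k : ℝ)).coeFn_toLp 2 volume,
    (quasiMeasurePreserving_affine 0 k).ae (f.coeFn_toLp 2 volume)] with t h₁ h₂ h₃
  rw [h₁, h₂, h₃]
  simp

theorem hat_translate (f : L2R) (k : ℤ) :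
    hat (atom f 0 k) =ᵐ[volume]
      fun x : ℝ => Complex.exp (2 * Real.pi * x * k * Complex.I) * hat f x := by
  refine denseRange_schwartz_toLp.induction_on
    (p := fun f => hat (atom f 0 k) =ᵐ[volume]
      fun x : ℝ => Complex.exp (2 * Real.pi * x * k * Complex.I) * hat f x) f
    (isClosed_setOf_ae_eq_mul_comp (continuous_hat.comp (continuous_atom 0 k)) continuous_hat
      (.id _) _) fun g => ?_
  simp only [atom_translate_toLp]
  filter_upwards [hat_toLp g, hat_toLp (g.compSubConstCLM ℂ (k : ℝ))] with x h₁ h₂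
  rw [h₁, h₂, ← integral_const_mul,
    ← integral_sub_right_eq_self (fun t : ℝ => Complex.exp (2 * Real.pi * x * k * Complex.I) *
      (Complex.exp (2 * Real.pi * x * t * Complex.I) * g t)) (k : ℝ)]
  congr 1 with t
  rw [← mul_assoc, ← Complex.exp_add, SchwartzMap.compSubConstCLM_apply]
  congr 2
  push_cast
  ring

theorem exists_schwartz_dilate (f : SchwartzMap ℝ ℂ) :
    ∃ g : SchwartzMap ℝ ℂ, (∀ t, g t = ((√2 : ℝ) : ℂ) * f (2 * t)) ∧
      atom (f.toLp 2) 1 0 = g.toLp 2 := by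
  let L : ℝ ≃L[ℝ] ℝ := ContinuousLinearEquiv.unitsEquivAut ℝ (Units.mk0 2 two_ne_zero)
  let g : SchwartzMap ℝ ℂ :=
    ((√2 : ℝ) : ℂ) • SchwartzMap.compCLMOfContinuousLinearEquiv ℂ L f
  have hg : ∀ t, g t = ((√2 : ℝ) : ℂ) * f (2 * t) := fun t => by
    simp [g, L, mul_comm]
  refine ⟨g, hg, Lp.ext ?_⟩
  filter_upwards [atom_coeFn (f.toLp 2) 1 0, g.coeFn_toLp 2 volume,
    (quasiMeasurePreserving_affine 1 0).ae (f.coeFn_toLp 2 volume)] with t h₁ h₂ h₃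
  rw [h₁, h₂, h₃, hg, Real.sqrt_eq_rpow]
  simp

theorem hat_dilate (f : L2R) :
    hat (atom f 1 0) =ᵐ[volume] fun x : ℝ => ((1 / √2 : ℝ) : ℂ) * hat f (x / 2) := by
  have hq : Measure.QuasiMeasurePreserving (fun x : ℝ => x / 2) volume volume := by
    simpa only [div_eq_inv_mul] using quasiMeasurePreserving_mul_left (a := 2⁻¹) (by norm_num)
  refine denseRange_schwartz_toLp.induction_on
    (p := fun f => hat (atom f 1 0) =ᵐ[volume]
      fun x : ℝ => ((1 / √2 : ℝ) : ℂ) * hat f (x / 2)) f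
    (isClosed_setOf_ae_eq_mul_comp (continuous_hat.comp (continuous_atom 1 0)) continuous_hat
      hq _) fun u => ?_
  obtain ⟨g, hg, h⟩ := exists_schwartz_dilate u
  simp only [h]
  filter_upwards [hat_toLp g, hq.ae (hat_toLp u)] with x h₁ h₂
  rw [h₁, h₂, ← integral_const_mul]
  -- Substituting `t ↦ 2t` costs a factor `2`, which turns `1/√2` into the `√2` of the dilation.
  have h₃ := Measure.integral_comp_mul_left (fun t : ℝ => ((1 / √2 : ℝ) : ℂ) *
    (Complex.exp (2 * Real.pi * ((x / 2 : ℝ) : ℂ) * t * Complex.I) * u t)) 2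
  have h₄ := congrArg (fun z : ℂ => (2 : ℝ) • z) h₃
  rw [abs_of_pos (by norm_num), smul_smul, mul_inv_cancel₀ two_ne_zero, one_smul,
    ← integral_smul] at h₄
  rw [← h₄]
  congr 1 with t
  have h₅ : ((√2 : ℝ) : ℂ) = 2 * ((1 / √2 : ℝ) : ℂ) := by
    norm_cast
    field_simp
    norm_num
  rw [hg, h₅, Complex.real_smul]
  push_cast
  ring_nf

/-! ### The isometries from `L²(𝕋)` and their Fourier picture -/

section Synthesis

variable {H : Type*} [NormedAddCommGroup H] [InnerProductSpace ℂ H] [CompleteSpace H]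
  {v : ℤ → H} (hv : Orthonormal ℂ v)

/-- The isometry `L²(𝕋) → H` sending `e_k` to `v_k`, for an orthonormal family `v`. -/
def synth (hv : Orthonormal ℂ v) : L2T →ₗᵢ[ℂ] H :=
  hv.orthogonalFamily.linearIsometry.comp fourierBasis.repr.toLinearIsometry

theorem hasSum_synth (ξ : L2T) : HasSum (fun j => inner ℂ (e j) ξ • v j) (synth hv ξ) := by
  have h := hv.orthogonalFamily.hasSum_linearIsometry (fourierBasis.repr ξ)
  simp only [LinearIsometry.toSpanSingleton_apply, HilbertBasis.repr_apply_apply,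
    coe_fourierBasis] at h
  exact h

theorem orthonormal_e : Orthonormal ℂ e := orthonormal_fourier

theorem synth_e (k : ℤ) : synth hv (e k) = v k := by
  have h := hasSum_single (f := fun j => inner ℂ (e j) (e k) • v j) k fun j hj => by
    simp [orthonormal_e.2 hj]
  simp only [inner_self_eq_norm_sq_to_K, orthonormal_e.1 k] at h
  simpa using (hasSum_synth hv (e k)).unique h

theorem inner_synth_eq_zero {x : H} (h : ∀ j, inner ℂ (v j) x = 0) (ξ : L2T) :
    inner ℂ (synth hv ξ) x = 0 := by
  rw [inner_eq_zero_symm]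
  have h₁ := (hasSum_synth hv ξ).mapL (innerSL ℂ x)
  have h₂ : ∀ j, inner ℂ x (v j) = 0 := fun j => inner_eq_zero_symm.1 (h j)
  simp only [map_smul, innerSL_apply_apply, h₂, smul_zero] at h₁
  exact h₁.unique hasSum_zero

end Synthesis

theorem hat_add (f g : L2R) : hat (f + g) = hat f + hat g :=
  (Lp.fourierTransformₗᵢ ℝ ℂ).symm.map_add f g

theorem hat_smul (c : ℂ) (f : L2R) : hat (c • f) = c • hat f :=
  (Lp.fourierTransformₗᵢ ℝ ℂ).symm.map_smul c f

/-- For `ξ = e_k` this is the modulation rule for translates; linearity and closedness of the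
relation extend it to all of `L²(𝕋)`. -/
theorem hat_synth {f : L2R} (hf : Orthonormal ℂ fun k : ℤ => atom f 0 k) (ξ : L2T) :
    hat (synth hf ξ) =ᵐ[volume] fun x : ℝ => hat f x * ξ (x : UnitAddCircle) := by
  have hq := quasiMeasurePreserving_coe_unitAddCircle
  have hdense : Dense (Submodule.span ℂ (Set.range e) : Set L2T) :=
    Submodule.dense_iff_topologicalClosure_eq_top.2
      (span_fourierLp_closure_eq_top ENNReal.ofNat_ne_top)
  have hcl : IsClosed {ξ : L2T | hat (synth hf ξ) =ᵐ[volume]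
      fun x : ℝ => hat f x * ξ (x : UnitAddCircle)} :=
    isClosed_setOf_ae_eq_mul_comp (continuous_hat.comp (synth hf).continuous) continuous_id hq _
  refine hcl.closure_subset_iff.2 (fun η hη => ?_) (hdense ξ)
  induction hη using Submodule.span_induction with
  | mem η h =>
    obtain ⟨k, rfl⟩ := h
    simp only [Set.mem_ofPred_eq, synth_e]
    filter_upwards [hat_translate f k, hq.ae (coeFn_fourierLp 2 k)] with x h₁ h₂
    rw [h₁, mul_comm]
    congr 1
    refine Eq.trans ?_ h₂.symm
    rw [fourier_coe_apply]
    congr 1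
    push_cast
    ring
  | zero =>
    simp only [Set.mem_ofPred_eq, map_zero]
    have h0 : hat 0 = 0 := (Lp.fourierTransformₗᵢ ℝ ℂ).symm.map_zero
    rw [h0]
    filter_upwards [Lp.coeFn_zero ℂ 2 (volume : Measure ℝ), hq.ae (Lp.coeFn_zero ℂ 2
      (AddCircle.haarAddCircle : Measure UnitAddCircle))] with x h₁ h₂
    rw [h₁, h₂]
    simp
  | add η ζ _ _ h₁ h₂ =>
    simp only [Set.mem_ofPred_eq, map_add, hat_add] at *
    filter_upwards [h₁, h₂, Lp.coeFn_add (hat (synth hf η)) (hat (synth hf ζ)),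
      hq.ae (Lp.coeFn_add η ζ)] with x h₁ h₂ h₃ h₄
    rw [h₃, h₄, Pi.add_apply, Pi.add_apply, h₁, h₂, mul_add]
  | smul c η _ h₁ =>
    simp only [Set.mem_ofPred_eq, map_smul, hat_smul] at *
    filter_upwards [h₁, Lp.coeFn_smul c (hat (synth hf η)),
      hq.ae (Lp.coeFn_smul c η)] with x h₁ h₃ h₄
    rw [h₃, h₄, Pi.smul_apply, Pi.smul_apply, h₁, smul_eq_mul, smul_eq_mul, mul_left_comm]

/-! ### The filter operators and the relation `∑ S_i S_i^* = 1` -/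

section Filters

variable {m₀ : Circle → ℂ} (hmeas : Measurable fun θ : UnitAddCircle => m₀ θ.toCircle)
  (hqmf : ∀ z : Circle, ‖m₀ z‖ ^ 2 + ‖m₀ (-z)‖ ^ 2 = 2)

theorem S_coeFn (i : Fin 2) (ξ : L2T) :
    S m₀ hmeas hqmf i ξ =ᵐ[AddCircle.haarAddCircle]
      fun θ => filt m₀ i θ.toCircle * ξ ((2 : ℤ) • θ) :=
  filterOp_coeFn _ _ ξ

/-- Two-scale relation: dilating the `n`-th packet space restricted to the range of `S_i`
gives the packet space of index `2n + i`. -/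
theorem dilate_synth_S {φ : ℕ → L2R} (hφ : IsPacketSequence m₀ φ)
    (ho : ∀ n, Orthonormal ℂ fun k : ℤ => atom (φ n) 0 k) (n : ℕ) (i : Fin 2) (ξ : L2T) :
    atom (synth (ho n) (S m₀ hmeas hqmf i ξ)) 1 0 = synth (ho (2 * n + i)) ξ := by
  have hq := quasiMeasurePreserving_coe_unitAddCircle
  have hh : Measure.QuasiMeasurePreserving (fun x : ℝ => x / 2) volume volume := by
    simpa only [div_eq_inv_mul] using quasiMeasurePreserving_mul_left (a := 2⁻¹) (by norm_num)
  refine hat_injective (Lp.ext ?_)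
  filter_upwards [hat_dilate (synth (ho n) (S m₀ hmeas hqmf i ξ)),
    hh.ae (hat_synth (ho n) (S m₀ hmeas hqmf i ξ)), hat_synth (ho (2 * n + i)) ξ, hφ n i,
    hh.ae (hq.ae (S_coeFn hmeas hqmf i ξ))] with x h₁ h₂ h₃ h₄ h₅
  have h₆ : (2 : ℤ) • ((x / 2 : ℝ) : UnitAddCircle) = (x : UnitAddCircle) := by
    rw [← AddCircle.coe_zsmul]
    congr 1
    rw [zsmul_eq_mul]
    push_cast
    ring
  rw [h₁, h₂, h₃, h₄, h₅, h₆, AddCircle.toCircle_apply_mk, div_one]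
  ring

theorem measurePreserving_add_half :
    MeasurePreserving (fun θ : UnitAddCircle => θ + ((1 / 2 : ℝ) : UnitAddCircle))
      AddCircle.haarAddCircle AddCircle.haarAddCircle :=
  measurePreserving_add_right _ _

theorem fourierCoeff_add_half (h : UnitAddCircle → ℂ) (k : ℤ) :
    fourierCoeff (fun θ => h (θ + ((1 / 2 : ℝ) : UnitAddCircle))) k =
      fourier k ((1 / 2 : ℝ) : UnitAddCircle) * fourierCoeff h k := by
  rw [fourierCoeff, fourierCoeff, ← integral_const_mul,
    ← integral_add_right_eq_self (fun θ => fourier k ((1 / 2 : ℝ) : UnitAddCircle) *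
      (fourier (-k) θ • h θ)) ((1 / 2 : ℝ) : UnitAddCircle)]
  congr 1 with θ
  have h₁ : fourier k ((1 / 2 : ℝ) : UnitAddCircle) *
      fourier (-k) ((1 / 2 : ℝ) : UnitAddCircle) = 1 := by
    rw [← fourier_add, add_neg_cancel, fourier_zero]
  have h₂ : fourier (-k) (θ + ((1 / 2 : ℝ) : UnitAddCircle)) =
      fourier (-k) θ * fourier (-k) ((1 / 2 : ℝ) : UnitAddCircle) := by
    simp only [fourier_apply, smul_add, AddCircle.toCircle_add, Circle.coe_mul]
  rw [h₂, smul_eq_mul, smul_eq_mul]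
  linear_combination (-(fourier (-k) θ * h (θ + ((1 / 2 : ℝ) : UnitAddCircle)))) * h₁

theorem fourier_half_of_odd {k : ℤ} (hk : Odd k) :
    fourier k ((1 / 2 : ℝ) : UnitAddCircle) = -1 := by
  obtain ⟨l, rfl⟩ := hk
  rw [fourier_coe_apply]
  have : (2 * Real.pi * Complex.I * ((2 * l + 1 : ℤ) : ℂ) * ((1 / 2 : ℝ) : ℂ) / ((1 : ℝ) : ℂ)) =
      l * (2 * Real.pi * Complex.I) + Real.pi * Complex.I := by
    push_cast
    ring
  rw [this, Complex.exp_add, Complex.exp_int_mul_two_pi_mul_I, Complex.exp_pi_mul_I, one_mul]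

theorem ae_eq_zero_of_fourierCoeff_eq_zero {h : UnitAddCircle → ℂ}
    (hh : MemLp h 2 AddCircle.haarAddCircle) (h0 : ∀ k, fourierCoeff h k = 0) :
    h =ᵐ[AddCircle.haarAddCircle] 0 := by
  have h₁ := hasSum_fourier_series_L2 hh.toLp
  have h₂ : ∀ k, fourierCoeff hh.toLp k = 0 := fun k => by
    rw [← h0 k]
    exact congrFun (fourierCoeff_congr_ae hh.coeFn_toLp) k
  simp only [h₂, zero_smul] at h₁
  have h₃ : hh.toLp = 0 := h₁.unique hasSum_zero
  exact hh.coeFn_toLp.symm.trans (h₃ ▸ Lp.coeFn_zero _ _ _)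

/-- A vector orthogonal to the range of `f ↦ m(z) f(z²)` satisfies
`conj (m z) g(z) + conj (m (-z)) g(-z) = 0`. -/
theorem ae_eq_of_orthogonal_filterOp {m : Circle → ℂ}
    (hm : MemLp (fun θ : UnitAddCircle => m θ.toCircle) ∞ AddCircle.haarAddCircle) {g : L2T}
    (hg : ∀ ξ, inner ℂ (filterOp m hm ξ) g = 0) :
    ∀ᵐ θ : UnitAddCircle ∂AddCircle.haarAddCircle,
      conj (m θ.toCircle) * g θ + conj (m (-θ.toCircle)) *
        g (θ + ((1 / 2 : ℝ) : UnitAddCircle)) = 0 := by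
  let h : UnitAddCircle → ℂ := fun θ => conj (m θ.toCircle) * g θ
  have hh : MemLp h 2 AddCircle.haarAddCircle := (Lp.memLp g).mul hm.star
  have hh' : MemLp (fun θ => h (θ + ((1 / 2 : ℝ) : UnitAddCircle))) 2 AddCircle.haarAddCircle :=
    hh.comp_measurePreserving measurePreserving_add_half
  -- Testing against `m(z) e_l(z²) = m(z) z^{2l}` reads off the even Fourier coefficients of `conj m
  -- · g`.
  have heven : ∀ l : ℤ, fourierCoeff h (2 * l) = 0 := fun l => by
    rw [← hg (e l), L2.inner_def, fourierCoeff]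
    refine integral_congr_ae ?_
    filter_upwards [filterOp_coeFn m hm (e l),
      measurePreserving_double.quasiMeasurePreserving.ae (coeFn_fourierLp 2 l)] with θ h₁ h₂
    have h₃ : e l ((2 : ℤ) • θ) = fourier (2 * l) θ := by
      refine h₂.trans ?_
      rw [fourier_apply, fourier_apply, smul_smul, mul_comm]
    rw [h₁, h₃, RCLike.inner_apply, map_mul, ← fourier_neg, smul_eq_mul]
    simp only [h]
    ring
  -- Symmetrizing under `z ↦ -z` kills the odd coefficients; the even ones already vanish.
  have hz : ∀ k, fourierCoeff (h + fun θ => h (θ + ((1 / 2 : ℝ) : UnitAddCircle))) k = 0 := by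
    intro k
    rw [fourierCoeff.add (hh.integrable one_le_two) (hh'.integrable one_le_two), Pi.add_apply,
      fourierCoeff_add_half]
    rcases Int.even_or_odd' k with ⟨l, rfl | rfl⟩
    · simp [heven]
    · rw [fourier_half_of_odd ⟨l, rfl⟩]
      ring
  filter_upwards [ae_eq_zero_of_fourierCoeff_eq_zero (hh.add hh') hz] with θ hθ
  simpa [h, neg_toCircle] using hθ

/-- The two orthogonality conditions form a linear system for `(g(z), g(-z))` whose matrix is `√2`
times a unitary, by the quadrature condition and the choice of `m₁`. -/
theorem eq_zero_of_orthogonal_S {g : L2T}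
    (hg : ∀ i ξ, inner ℂ (S m₀ hmeas hqmf i ξ) g = 0) : g = 0 := by
  refine (Lp.eq_zero_iff_ae_eq_zero).2 ?_
  filter_upwards [ae_eq_of_orthogonal_filterOp (filt_memLp m₀ hmeas hqmf 0) (hg 0),
    ae_eq_of_orthogonal_filterOp (filt_memLp m₀ hmeas hqmf 1) (hg 1)] with θ h₀ h₁
  have hq : conj (m₀ θ.toCircle) * m₀ θ.toCircle + conj (m₀ (-θ.toCircle)) * m₀ (-θ.toCircle)
      = 2 := by
    rw [RCLike.conj_mul, RCLike.conj_mul]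
    simpa using congrArg (fun r : ℝ => (r : ℂ)) (hqmf θ.toCircle)
  have hz : conj (θ.toCircle : ℂ) * (θ.toCircle : ℂ) = 1 := by
    rw [RCLike.conj_mul, Circle.norm_coe]
    simp
  simp only [filt, Matrix.cons_val_zero, Matrix.cons_val_one, map_mul, Complex.conj_conj,
    neg_neg, Circle.coe_neg, map_neg] at h₀ h₁
  have h2 : (2 : ℂ) * g θ = 0 := by
    -- The multipliers `m₀(z)` and `z conj (m₀(-z))` cancel the `g(-z)` terms once `|z|² = 1`.
    linear_combination (m₀ θ.toCircle) * h₀ +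
      (θ.toCircle : ℂ) * conj (m₀ (-θ.toCircle)) * h₁ - g θ * hq -
      (conj (m₀ (-θ.toCircle)) * m₀ (-θ.toCircle) * g θ -
        conj (m₀ (-θ.toCircle)) * m₀ (θ.toCircle) *
          g (θ + ((1 / 2 : ℝ) : UnitAddCircle))) * hz
  simpa using h2

/-- Given the isometry relations, `ξ - ∑ S_i S_i^* ξ` is orthogonal to every range. -/
theorem sum_S_adjoint
    (hS : ∀ i j ξ η, inner ℂ (S m₀ hmeas hqmf i ξ) (S m₀ hmeas hqmf j η) =
      if i = j then inner ℂ ξ η else 0) (ξ : L2T) :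
    ∑ i, S m₀ hmeas hqmf i (ContinuousLinearMap.adjoint (S m₀ hmeas hqmf i) ξ) = ξ := by
  rw [eq_comm, ← sub_eq_zero]
  refine eq_zero_of_orthogonal_S hmeas hqmf fun j η => ?_
  rw [inner_sub_right, inner_sum, Finset.sum_congr rfl fun i _ => hS j i η _,
    Finset.sum_ite_eq, if_pos (Finset.mem_univ j), ContinuousLinearMap.adjoint_inner_right,
    sub_self]

end Filters

/-! ### Iterated dilations and dyadic indices -/

theorem atom_translate_dilate (f : L2R) (p : ℕ) (k : ℤ) :
    atom (atom f 0 k) p 0 = atom f p k := by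
  induction p with
  | zero => exact atom_zero_zero _
  | succ p ih => rw [← atom_atom, ih, atom_atom]

theorem atom_dilate_dilate (f : L2R) (p : ℕ) : atom (atom f 1 0) p 0 = atom f (p + 1) 0 := by
  induction p with
  | zero => exact atom_zero_zero _
  | succ p ih => rw [← atom_atom, ih, atom_atom]

theorem packetIndex_succ (p n : ℕ) (i : Fin (p + 1) → Fin 2) :
    packetIndex (p + 1) n i = packetIndex p (2 * n + i 0) (Fin.tail i) := by
  rw [packetIndex, packetIndex, Fin.sum_univ_succ, mul_add, ← add_assoc]
  congr 1
  · simp only [Fin.val_zero, add_tsub_cancel_right, tsub_zero]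
    ring
  · refine Finset.sum_congr rfl fun r _ => ?_
    rw [Fin.tail, Fin.val_succ, show p + 1 - 1 - (r + 1 : ℕ) = p - 1 - r by omega]

/-- A dyadic block is halved at its midpoint `2^p (2n + 1)`. -/
theorem mem_block_succ {p n m : ℕ} :
    m ∈ block (p + 1, n) ↔ ∃ i : Fin 2, m ∈ block (p, 2 * n + i) := by
  have h₁ : 2 ^ (p + 1) * n = 2 ^ p * (2 * n) := by ring
  have h₂ : 2 ^ (p + 1) * (n + 1) = 2 ^ p * (2 * n + 1 + 1) := by ring
  have h₃ : 2 ^ p * (2 * n) ≤ 2 ^ p * (2 * n + 1) := Nat.mul_le_mul_left _ (by omega)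
  have h₄ : 2 ^ p * (2 * n + 1) ≤ 2 ^ p * (2 * n + 1 + 1) := Nat.mul_le_mul_left _ (by omega)
  simp only [block, Set.mem_Ico, Fin.exists_fin_two, Fin.val_zero, Fin.val_one, add_zero, h₁, h₂]
  omega

theorem mem_block_zero {n m : ℕ} : m ∈ block (0, n) ↔ m = n := by
  simp only [block, Set.mem_Ico, pow_zero, one_mul]
  omega

/-! ### Expansion of dilated packet spaces -/

section Packets

variable {U : ℕ → L2T →ₗᵢ[ℂ] L2R} {T : Fin 2 → L2T →L[ℂ] L2T}

theorem dilate_eq_sum (hU : ∀ n i ξ, atom (U n (T i ξ)) 1 0 = U (2 * n + (i : ℕ)) ξ)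
    (hT : ∀ ξ, ∑ i, T i (ContinuousLinearMap.adjoint (T i) ξ) = ξ) (n : ℕ) (ξ : L2T) :
    atom (U n ξ) 1 0 =
      ∑ i : Fin 2, U (2 * n + (i : ℕ)) (ContinuousLinearMap.adjoint (T i) ξ) := by
  conv_lhs => rw [← hT ξ]
  rw [map_sum, ← atomₗᵢ_apply, map_sum]
  exact Finset.sum_congr rfl fun i _ => hU n i _

theorem atom_succ_eq_sum (hU : ∀ n i ξ, atom (U n (T i ξ)) 1 0 = U (2 * n + (i : ℕ)) ξ)
    (hT : ∀ ξ, ∑ i, T i (ContinuousLinearMap.adjoint (T i) ξ) = ξ) (p n : ℕ) (ξ : L2T) :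
    atom (U n ξ) (p + 1) 0 =
      ∑ i : Fin 2, atom (U (2 * n + (i : ℕ)) (ContinuousLinearMap.adjoint (T i) ξ)) p 0 := by
  rw [← atom_dilate_dilate, dilate_eq_sum hU hT, ← atomₗᵢ_apply, map_sum]
  rfl

theorem atom_eq_sum_adjWord (hU : ∀ n i ξ, atom (U n (T i ξ)) 1 0 = U (2 * n + (i : ℕ)) ξ)
    (hT : ∀ ξ, ∑ i, T i (ContinuousLinearMap.adjoint (T i) ξ) = ξ) (p n : ℕ) (ξ : L2T) :
    atom (U n ξ) p 0 = ∑ i : Fin p → Fin 2, U (packetIndex p n i) (adjWord T p i ξ) := by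
  induction p generalizing n ξ with
  | zero => simp [atom_zero_zero, packetIndex, adjWord]
  | succ p ih =>
    -- The digit `i_1` is split off: its adjoint acts first, and it is the leading digit of the
    -- index.
    rw [atom_succ_eq_sum hU hT, ← (Fin.consEquiv fun _ => Fin 2).sum_comp,
      Fintype.sum_prod_type]
    refine Finset.sum_congr rfl fun i _ => ?_
    rw [ih]
    refine Finset.sum_congr rfl fun w _ => ?_
    rw [packetIndex_succ]
    simp [Fin.consEquiv, adjWord]

/-- The witness is `T_{i_1} ⋯ T_{i_p} ξ`, with `i_1, …, i_p` the binary digits of `m - 2^p n`. -/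
theorem exists_atom_eq_of_mem_block
    (hU : ∀ n i ξ, atom (U n (T i ξ)) 1 0 = U (2 * n + (i : ℕ)) ξ) {p n m : ℕ}
    (hm : m ∈ block (p, n)) (ξ : L2T) : ∃ η, atom (U n η) p 0 = U m ξ := by
  induction p generalizing n with
  | zero =>
    rw [mem_block_zero.1 hm]
    exact ⟨ξ, atom_zero_zero _⟩
  | succ p ih =>
    obtain ⟨i, hi⟩ := mem_block_succ.1 hm
    obtain ⟨η, hη⟩ := ih hi
    exact ⟨T i η, by rw [← atom_dilate_dilate, hU, hη]⟩

/-- The converse inclusion of ranges, phrased by orthogonality so that no sum of subspaces has to be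
formed. -/
theorem inner_atom_eq_zero_of_block
    (hU : ∀ n i ξ, atom (U n (T i ξ)) 1 0 = U (2 * n + (i : ℕ)) ξ)
    (hT : ∀ ξ, ∑ i, T i (ContinuousLinearMap.adjoint (T i) ξ) = ξ) {p n : ℕ} {y : L2R}
    (hy : ∀ m ∈ block (p, n), ∀ η, inner ℂ (U m η) y = 0) (ξ : L2T) :
    inner ℂ (atom (U n ξ) p 0) y = 0 := by
  induction p generalizing n ξ with
  | zero =>
    rw [atom_zero_zero]
    exact hy n (mem_block_zero.2 rfl) ξ
  | succ p ih =>
    rw [atom_succ_eq_sum hU hT, sum_inner]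
    exact Finset.sum_eq_zero fun i _ => ih (fun m hm => hy m (mem_block_succ.2 ⟨i, hm⟩)) _

theorem inner_atom_eq_zero_of_disjoint
    (hU : ∀ n i ξ, atom (U n (T i ξ)) 1 0 = U (2 * n + (i : ℕ)) ξ)
    (hT : ∀ ξ, ∑ i, T i (ContinuousLinearMap.adjoint (T i) ξ) = ξ)
    (hort : ∀ m n, m ≠ n → ∀ ξ η, inner ℂ (U m ξ) (U n η) = 0) {p n p' n' : ℕ}
    (hd : Disjoint (block (p, n)) (block (p', n'))) (ξ η : L2T) :
    inner ℂ (atom (U n ξ) p 0) (atom (U n' η) p' 0) = 0 := by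
  refine inner_atom_eq_zero_of_block hU hT (fun m hm ζ => ?_) ξ
  rw [inner_eq_zero_symm]
  refine inner_atom_eq_zero_of_block hU hT (fun m' hm' ζ' => hort m' m ?_ _ _) η
  exact (hd.ne_of_mem hm hm').symm

end Packets

theorem span_e_topologicalClosure :
    (Submodule.span ℂ (Set.range e)).topologicalClosure = ⊤ :=
  span_fourierLp_closure_eq_top ENNReal.ofNat_ne_top

/-- A vector orthogonal to a family with dense span is zero. -/
theorem IsONB.eq_zero_of_inner {ι H : Type*} [NormedAddCommGroup H] [InnerProductSpace ℂ H]
    {v : ι → H} (hv : IsONB v) {y : H} (hy : ∀ i, inner ℂ (v i) y = 0) : y = 0 := by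
  have hd := Submodule.dense_iff_topologicalClosure_eq_top.2 hv.2
  refine hd.eq_zero_of_inner_right ℂ fun x hx => ?_
  induction hx using Submodule.span_induction with
  | mem x h =>
    obtain ⟨i, rfl⟩ := h
    exact hy i
  | zero => simp
  | add x z _ _ h₁ h₂ => rw [inner_add_left, h₁, h₂, add_zero]
  | smul c x _ h => rw [inner_smul_left, h, mul_zero]

/-- The isometric image of `L²(𝕋)` lies in a closed subspace containing the images of the `e_k`. -/
theorem map_mem_of_forall_e {H : Type*} [NormedAddCommGroup H] [InnerProductSpace ℂ H]
    (A : L2T →ₗᵢ[ℂ] H) {K : Submodule ℂ H} (hK : IsClosed (K : Set H))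
    (h : ∀ k, A (e k) ∈ K) (ξ : L2T) : A ξ ∈ K := by
  have h₁ : Submodule.span ℂ (Set.range e) ≤ K.comap A.toLinearMap :=
    Submodule.span_le.2 (by rintro _ ⟨k, rfl⟩; exact h k)
  have h₂ : (Submodule.span ℂ (Set.range e)).topologicalClosure ≤ K.comap A.toLinearMap :=
    Submodule.topologicalClosure_minimal _ h₁ (hK.preimage A.continuous)
  rw [span_e_topologicalClosure] at h₂
  exact h₂ Submodule.mem_top

/-! ### ONB criterion -/

section Criterion

variable {U : ℕ → L2T →ₗᵢ[ℂ] L2R} {T : Fin 2 → L2T →L[ℂ] L2T}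

theorem isONB_of_partition
    (hU : ∀ n i ξ, atom (U n (T i ξ)) 1 0 = U (2 * n + (i : ℕ)) ξ)
    (hT : ∀ ξ, ∑ i, T i (ContinuousLinearMap.adjoint (T i) ξ) = ξ)
    (hort : ∀ m n, m ≠ n → ∀ ξ η, inner ℂ (U m ξ) (U n η) = 0)
    (hONB : IsONB fun q : ℕ × ℤ => U q.1 (e q.2)) {J : Set (ℕ × ℕ)}
    (hd : J.PairwiseDisjoint block) (hc : ⋃ q ∈ J, block q = Set.univ) :
    IsONB fun q : J × ℤ => atom (U q.1.1.2 (e q.2)) q.1.1.1 0 := by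
  refine ⟨⟨fun q => ?_, ?_⟩, ?_⟩
  · rw [norm_atom, LinearIsometry.norm_map, orthonormal_e.1]
  · rintro ⟨q, k⟩ ⟨q', k'⟩ hne
    by_cases hq : q = q'
    · subst hq
      have hk : k ≠ k' := fun h => hne (by rw [h])
      dsimp only
      rw [← atomₗᵢ_apply, ← atomₗᵢ_apply, LinearIsometry.inner_map_map,
        LinearIsometry.inner_map_map]
      exact orthonormal_e.2 hk
    · exact inner_atom_eq_zero_of_disjoint hU hT hort
        (hd q.2 q'.2 fun h => hq (Subtype.ext h)) _ _
  · rw [eq_top_iff, ← hONB.2]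
    refine Submodule.topologicalClosure_minimal _ (Submodule.span_le.2 ?_)
      (Submodule.isClosed_topologicalClosure _)
    rintro _ ⟨⟨m, k⟩, rfl⟩
    obtain ⟨q, hqJ, hm⟩ : ∃ q ∈ J, m ∈ block q := by
      have := hc.symm ▸ Set.mem_univ m
      simpa using this
    obtain ⟨η, hη⟩ := exists_atom_eq_of_mem_block hU hm (e k)
    dsimp only
    rw [← hη]
    exact map_mem_of_forall_e ((atomₗᵢ q.1 0).comp (U q.2)) (K := Submodule.topologicalClosure
      (Submodule.span ℂ (Set.range fun q : J × ℤ => atom (U q.1.1.2 (e q.2)) q.1.1.1 0)))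
      (Submodule.isClosed_topologicalClosure _)
      (fun l => Submodule.le_topologicalClosure _ (Submodule.subset_span ⟨(⟨q, hqJ⟩, l), rfl⟩)) η

theorem partition_of_isONB
    (hU : ∀ n i ξ, atom (U n (T i ξ)) 1 0 = U (2 * n + (i : ℕ)) ξ)
    (hT : ∀ ξ, ∑ i, T i (ContinuousLinearMap.adjoint (T i) ξ) = ξ)
    (hort : ∀ m n, m ≠ n → ∀ ξ η, inner ℂ (U m ξ) (U n η) = 0) {J : Set (ℕ × ℕ)}
    (hJ : IsONB fun q : J × ℤ => atom (U q.1.1.2 (e q.2)) q.1.1.1 0) :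
    J.PairwiseDisjoint block ∧ ⋃ q ∈ J, block q = Set.univ := by
  have hne : ∀ m, U m (e 0) ≠ 0 := fun m h => by
    have := (U m).norm_map (e 0)
    rw [h, orthonormal_e.1, norm_zero] at this
    exact zero_ne_one this
  constructor
  · intro q hq q' hq' hqq
    -- For `m` in two blocks, `U_m e_0` lies in two mutually orthogonal spaces, hence is orthogonal
    -- to itself.
    refine Set.disjoint_left.2 fun m hm hm' => hne m ?_
    obtain ⟨η, hη⟩ := exists_atom_eq_of_mem_block hU hm (e 0)
    obtain ⟨η', hη'⟩ := exists_atom_eq_of_mem_block hU hm' (e 0)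
    rw [← inner_self_eq_zero (𝕜 := ℂ)]
    nth_rw 1 [← hη]
    rw [← hη']
    have hclosed : ∀ y : L2R, IsClosed (((ℂ ∙ y)ᗮ : Submodule ℂ L2R) : Set L2R) :=
      fun y => Submodule.isClosed_orthogonal _
    have h₁ : ∀ k ξ, inner ℂ (atom (U q'.2 (e k)) q'.1 0) (atom (U q.2 ξ) q.1 0) = 0 :=
      fun k ξ => Submodule.mem_orthogonal_singleton_iff_inner_right.1
        (map_mem_of_forall_e ((atomₗᵢ q.1 0).comp (U q.2)) (hclosed _)
          (fun l => Submodule.mem_orthogonal_singleton_iff_inner_right.2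
            (hJ.1.2 (i := (⟨q', hq'⟩, k)) (j := (⟨q, hq⟩, l)) fun h =>
              hqq (congrArg (fun x => x.1.1) h).symm)) ξ)
    exact Submodule.mem_orthogonal_singleton_iff_inner_right.1
      (map_mem_of_forall_e ((atomₗᵢ q'.1 0).comp (U q'.2)) (hclosed _)
        (fun l => Submodule.mem_orthogonal_singleton_iff_inner_right.2
          (inner_eq_zero_symm.1 (h₁ l η))) η')
  · by_contra hc
    obtain ⟨m, hm⟩ := (Set.ne_univ_iff_exists_notMem _).1 hc
    -- For `m` in no block, `U_m e_0` is orthogonal to the whole family.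
    refine hne m (hJ.eq_zero_of_inner fun q => ?_)
    refine inner_atom_eq_zero_of_block hU hT (fun m' hm' η => hort m' m ?_ _ _) _
    rintro rfl
    exact hm (Set.mem_biUnion q.1.2 hm')

end Criterion

end WaveletPacket

end

theorem theorem3p1 (m₀ : Circle → ℂ)
    (hmeas : Measurable fun θ : UnitAddCircle => m₀ θ.toCircle)
    (h_one : m₀ 1 = ((√2 : ℝ) : ℂ))
    (hqmf : ∀ z : Circle, ‖m₀ z‖ ^ 2 + ‖m₀ (-z)‖ ^ 2 = 2)
    (φ : ℕ → WaveletPacket.L2R)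
    (hφ : WaveletPacket.IsPacketSequence m₀ φ)
    (hONB : WaveletPacket.IsONB fun q : ℕ × ℤ => WaveletPacket.atom (φ q.1) 0 q.2) :
    (∀ (p n : ℕ) (k : ℤ),
      (∀ i : Fin p → Fin 2, Summable fun j : ℤ =>
        inner ℂ (WaveletPacket.e j)
            (WaveletPacket.adjWord (WaveletPacket.S m₀ hmeas hqmf) p i (WaveletPacket.e k)) •
          WaveletPacket.atom (φ (WaveletPacket.packetIndex p n i)) 0 j) ∧
      WaveletPacket.atom (φ n) p k =
        ∑ i : Fin p → Fin 2, ∑' j : ℤ,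
          inner ℂ (WaveletPacket.e j)
              (WaveletPacket.adjWord (WaveletPacket.S m₀ hmeas hqmf) p i (WaveletPacket.e k)) •
            WaveletPacket.atom (φ (WaveletPacket.packetIndex p n i)) 0 j) ∧
    ∀ J : Set (ℕ × ℕ),
      (WaveletPacket.IsONB fun q : J × ℤ =>
          WaveletPacket.atom (φ q.1.1.2) q.1.1.1 q.2) ↔
        J.PairwiseDisjoint WaveletPacket.block ∧ ⋃ q ∈ J, WaveletPacket.block q = Set.univ := by
  open WaveletPacket in
  have ho : ∀ n, Orthonormal ℂ fun k : ℤ => atom (φ n) 0 k := fun n =>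
    hONB.1.comp (fun k : ℤ => (n, k)) (Prod.mk_right_injective n)
  have hU : ∀ n i ξ, atom (synth (ho n) (S m₀ hmeas hqmf i ξ)) 1 0 =
      synth (ho (2 * n + (i : ℕ))) ξ := dilate_synth_S hmeas hqmf hφ ho
  have hort : ∀ m n, m ≠ n → ∀ ξ η, inner ℂ (synth (ho m) ξ) (synth (ho n) η) = 0 :=
    fun m n hmn ξ η => inner_synth_eq_zero _ (fun j => inner_eq_zero_symm.1 <|
      inner_synth_eq_zero _ (fun l => hONB.1.2 (i := (n, l)) (j := (m, j))
        fun h => hmn (congrArg Prod.fst h).symm) η) ξ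
  have hT : ∀ ξ, ∑ i, S m₀ hmeas hqmf i
      (ContinuousLinearMap.adjoint (S m₀ hmeas hqmf i) ξ) = ξ := by
    refine sum_S_adjoint hmeas hqmf fun i j ξ η => ?_
    -- Applying the isometry `D U_0` moves the inner product to `U_i ξ` and `U_j η`, where
    -- orthonormality of the packets decides it.
    rw [← (synth (ho 0)).inner_map_map, ← (atomₗᵢ 1 0).inner_map_map, atomₗᵢ_apply, atomₗᵢ_apply,
      hU, hU]
    split_ifs with hij
    · rw [hij, LinearIsometry.inner_map_map]
    · exact hort _ _ (fun h => hij (Fin.ext (by simpa using h))) _ _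
  have hatom : ∀ p n k, atom (φ n) p k = atom (synth (ho n) (e k)) p 0 := fun p n k => by
    rw [synth_e, atom_translate_dilate]
  refine ⟨fun p n k => ⟨fun i => (hasSum_synth (ho _) _).summable, ?_⟩, fun J => ?_⟩
  · rw [hatom, atom_eq_sum_adjWord (U := fun n => synth (ho n)) hU hT]
    exact Finset.sum_congr rfl fun i _ => (hasSum_synth (ho _) _).tsum_eq.symm
  · have hbase : (fun q : ℕ × ℤ => atom (φ q.1) 0 q.2) = fun q => synth (ho q.1) (e q.2) :=
      funext fun q => (synth_e (ho q.1) q.2).symm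
    have hfam : (fun q : J × ℤ => atom (φ q.1.1.2) q.1.1.1 q.2) =
        fun q => atom (synth (ho q.1.1.2) (e q.2)) q.1.1.1 0 := funext fun q => hatom _ _ _
    rw [hbase] at hONB
    rw [hfam]
    exact ⟨partition_of_isONB (U := fun n => synth (ho n)) hU hT hort,
      fun h => isONB_of_partition (U := fun n => synth (ho n)) hU hT hort hONB h.1 h.2⟩
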